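/- Let $G$ be a torsion group whose center has finite index in $G$. Let $R$ be a (not necessarily commutative) semiprime ring with $1$ such that, for every prime $p$ for which $R$ has $p$-torsion elements (i.e. $pr=0$ for some $0\neq r\in R$), $p$ does not divide the order of $G$, i.e. $p$ does not divide the order of any element of $G$ (for finite $G$: $p\nmid |G|$); in particular, $R$ may be any semiprime ring without torsion elements. Let $\sigma,\tau$ be $R$-linear ring endomorphisms of the group ring $RG$ that fix the center of $RG$ pointwise. For a ring $T$ containing $R$ with the same $1$ and with $\mathcal Z(R)\subseteq\mathcal Z(T)$, let $\sigma_T,\tau_T$ be the natural extensions of $\sigma,\tau$ to $TG$, i.e. the $T$-linear ring endomorphisms $\sum_g t_g g\mapsto\sum_g t_g\sigma(g)$ and $\sum_g t_g g\mapsto\sum_g t_g\tau(g)$. A $T$-linear $(\sigma_T,\tau_T)$-derivation of $TG$ is a left $T$-linear map $\delta:TG\to TG$ with $\delta(ab)=\delta(a)\tau_T(b)+\sigma_T(a)\delta(b)$ for all $a,b\in TG$; it is inner if there is $x\in TG$ with $\delta(a)=x\tau_T(a)-\sigma_T(a)x$ for all $a\in TG$. Let $H^1(TG,{}_\sigma TG_\tau)$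 be the group of $T$-linear $(\sigma_T,\tau_T)$-derivations of $TG$ modulo the inner ones. The $R$-linear $(\sigma,\tau)$-derivations of $RG$ are defined in the same way. Then there is a ring $T\supseteq R$ with the same $1$ and with $\mathcal Z(T)\supseteq\mathcal Z(R)$ such that $$H^1(TG,{}_\sigma TG_\tau)=0 .$$ In particular, every $R$-linear $(\sigma,\tau)$-derivation $\delta$ of $RG$ becomes inner over $T$: there is $\alpha\in TG$ with $\delta(x)=\alpha\tau(x)-\sigma(x)\alpha$ for all $x\in RG$. -/

import Mathlib

universe u v

/-- A (not necessarily commutative) ring is semiprime if `a R a = 0` implies `a = 0`. -/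
def IsSemiprimeRing (R : Type u) [Ring R] : Prop :=
  ∀ a : R, (∀ r : R, a * r * a = 0) → a = 0

/-- `R` has `p`-torsion elements: a nonzero element is annihilated by `p`. -/
def HasTorsionAt (R : Type u) [Ring R] (p : ℕ) : Prop :=
  ∃ r : R, r ≠ 0 ∧ p • r = 0

namespace TwistedDer

section Cohomology

variable (S : Type u) [Ring S] {A : Type v} [Ring A] [Module S A]

/-- The `S`-linear `(σ, τ)`-derivations of `A`, that is, the `S`-linear derivations of `A` with
values in the bimodule `_σ A_τ` (`a` acts on the left as `σ a`, on the right as `τ a`). -/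
def derivations (σ τ : A →+* A) : AddSubgroup (A →ₗ[S] A) where
  carrier := {δ | ∀ a b : A, δ (a * b) = δ a * τ b + σ a * δ b}
  zero_mem' := by intro a b; simp
  add_mem' := by
    intro δ ε hδ hε a b
    simp only [LinearMap.add_apply, hδ a b, hε a b, add_mul, mul_add]
    abel
  neg_mem' := by
    intro δ hδ a b
    simp only [LinearMap.neg_apply, hδ a b, neg_mul, mul_neg, neg_add]

/-- The `S`-linear maps of the form `a ↦ x τ(a) - σ(a) x` with `x` in `A`. -/
def innerMaps (σ τ : A →+* A) : AddSubgroup (A →ₗ[S] A) where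
  carrier := {δ | ∃ x : A, ∀ a : A, δ a = x * τ a - σ a * x}
  zero_mem' := ⟨0, by simp⟩
  add_mem' := by
    rintro δ ε ⟨x, hx⟩ ⟨y, hy⟩
    refine ⟨x + y, fun a => ?_⟩
    simp only [LinearMap.add_apply, hx a, hy a, add_mul, mul_add]
    abel
  neg_mem' := by
    rintro δ ⟨x, hx⟩
    refine ⟨-x, fun a => ?_⟩
    simp only [LinearMap.neg_apply, hx a, neg_mul, mul_neg]
    abel

/-- `H¹(A, _σ A_τ)`, relative to the coefficient ring `S`: the group of `S`-linear
`(σ, τ)`-derivations of `A` modulo the `(σ, τ)`-inner ones. -/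
abbrev H1 (σ τ : A →+* A) : Type v :=
  derivations S σ τ ⧸ (innerMaps S σ τ).addSubgroupOf (derivations S σ τ)

end Cohomology

open MonoidAlgebra

variable {R : Type u} [Ring R] {G : Type v} [Group G]

/-- An `R`-linear ring endomorphism of the group ring `RG` that fixes the center of `RG`
pointwise. -/
structure IsCentralEndo (σ : MonoidAlgebra R G →+* MonoidAlgebra R G) : Prop where
  map_smul : ∀ (r : R) (x : MonoidAlgebra R G), σ (r • x) = r • σ x
  fix_center : ∀ x ∈ Subring.center (MonoidAlgebra R G), σ x = x

/-- The elements `σ g` have their coefficients in the center of `R`. -/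
theorem IsCentralEndo.coeff_mem_center {σ : MonoidAlgebra R G →+* MonoidAlgebra R G}
    (hσ : IsCentralEndo σ) (g h : G) :
    (σ (single g 1)).coeff h ∈ Subring.center R := by
  rw [Subring.mem_center_iff]
  intro r
  have h1 : σ (single 1 r) = single 1 r := by
    have e : (single 1 r : MonoidAlgebra R G) = r • 1 := by
      simp [MonoidAlgebra.one_def]
    rw [e, hσ.map_smul, map_one]
  have h2 : σ (single 1 r * single g 1) = σ (single g 1 * single 1 r) := by
    simp [MonoidAlgebra.single_mul_single]
  rw [map_mul, map_mul, h1] at h2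
  have h3 := congrArg (fun y : MonoidAlgebra R G => y.coeff h) h2
  simpa [coeff_single_one_mul, coeff_mul_single_one] using h3

variable {T : Type u} [Ring T]

/-- The natural extension `σ_T` of `σ` to `TG`, along a ring homomorphism `i : R → T` carrying the
center of `R` into the center of `T`: the `T`-linear ring endomorphism
`∑ t_g g ↦ ∑ t_g σ(g)`, where the coefficients of `σ(g)` are read in `T`. -/
noncomputable def natExt (i : R →+* T) (hi : ∀ z ∈ Subring.center R, i z ∈ Subring.center T)
    (σ : MonoidAlgebra R G →+* MonoidAlgebra R G) (hσ : IsCentralEndo σ) :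
    MonoidAlgebra T G →+* MonoidAlgebra T G :=
  liftNCRingHom singleOneRingHom
    (((mapRingHom G i).comp σ : MonoidAlgebra R G →* MonoidAlgebra T G).comp (of R G))
    (by
      intro t g
      ext h
      have := (Subring.mem_center_iff.1 (hi _ (hσ.coeff_mem_center g h))) t
      simpa [coeff_single_one_mul, coeff_mul_single_one] using this)

theorem natExt_smul (i : R →+* T) (hi : ∀ z ∈ Subring.center R, i z ∈ Subring.center T)
    (σ : MonoidAlgebra R G →+* MonoidAlgebra R G) (hσ : IsCentralEndo σ)
    (t : T) (x : MonoidAlgebra T G) :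
    natExt i hi σ hσ (t • x) = t • natExt i hi σ hσ x := by
  have e : ∀ y : MonoidAlgebra T G, t • y = single 1 t * y := by
    intro y
    ext h
    simp
  have h1 : natExt i hi σ hσ (single 1 t) = single 1 t :=
    (liftNCRingHom_single _ _ _ _ _).trans (by simp [← MonoidAlgebra.one_def])
  rw [e, e, map_mul, h1]

theorem natExt_mapRingHom (i : R →+* T) (hi : ∀ z ∈ Subring.center R, i z ∈ Subring.center T)
    (σ : MonoidAlgebra R G →+* MonoidAlgebra R G) (hσ : IsCentralEndo σ)
    (x : MonoidAlgebra R G) :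
    natExt i hi σ hσ (mapRingHom G i x) = mapRingHom G i (σ x) := by
  have e : ∀ (r : R) (y : MonoidAlgebra R G),
      mapRingHom G i (r • y) = i r • mapRingHom G i y := by
    intro r y
    ext h
    simp
  induction x using MonoidAlgebra.induction_on with
  | of g =>
    have h1 : mapRingHom G i (of R G g) = single g 1 := by simp
    rw [h1]
    exact (liftNCRingHom_single _ _ _ _ _).trans (by simp [← MonoidAlgebra.one_def])
  | add x y hx hy => simp only [map_add, hx, hy]
  | smul r x hx => rw [e, natExt_smul, hx, hσ.map_smul, e]

end TwistedDer

/-! Both endomorphisms fix a central group element `z` of order `n`, so `0 = δ(zⁿ) = n zⁿ⁻¹ δ(z)`,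
and absence of `n`-torsion gives `δ(z) = 0` (`derivation_apply_central_eq_zero`). Hence `δ(g)
τ(g⁻¹)` depends only on the coset of `g` modulo the center. As in Maschke's theorem, its sum `β`
over the cosets makes the index times `δ` inner (`exists_index_nsmul_eq_inner`).

It remains to divide by the index. By Cauchy's theorem its prime divisors divide orders of elements
of `G`, so it is regular on `R` and becomes a unit when the regular integers are inverted
(`exists_natCast_localization`). -/

/-- Natural numbers without torsion can be inverted: a ring embeds, with its center going to the
center, in a ring in which they are all units. -/
theorem exists_natCast_localization (R : Type u) [Ring R] :
    ∃ (T : Type u) (_ : Ring T) (i : R →+* T),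
      (∀ z ∈ Subring.center R, i z ∈ Subring.center T) ∧ Function.Injective i ∧
      ∀ m : ℕ, (∀ r : R, (m : R) * r = 0 → r = 0) → IsUnit (m : T) := by
  let S : Submonoid R :=
    { carrier := {s | (∃ m : ℕ, (m : R) = s) ∧ ∀ r : R, s * r = 0 → r = 0}
      one_mem' := ⟨⟨1, Nat.cast_one⟩, by simp⟩
      mul_mem' := by
        rintro _ _ ⟨⟨m, rfl⟩, hm⟩ ⟨⟨k, rfl⟩, hk⟩
        exact ⟨⟨m * k, Nat.cast_mul m k⟩, fun r hr => hk r (hm _ (by rwa [← mul_assoc]))⟩ }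
  have hcomm : ∀ (s : S) (r : R), (s : R) * r = r * s := by
    rintro ⟨_, ⟨m, rfl⟩, hm⟩ r
    exact Nat.cast_comm m r
  -- The denominators are central, so the Ore condition only swaps the two factors.
  let : OreLocalization.OreSet S :=
    { ore_right_cancel := fun r₁ r₂ s h => ⟨s, by rw [hcomm, hcomm, h]⟩
      oreNum := fun r _ => r
      oreDenom := fun _ s => s
      ore_eq := fun r s => hcomm s r }
  let i : R →+* OreLocalization S R :=
    { (OreLocalization.numeratorHom : R →* OreLocalization S R) with
      map_zero' := OreLocalization.zero_oreDiv 1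
      map_add' := fun x y => (OreLocalization.add_oreDiv (r := x) (r' := y) (s := 1)).symm }
  have hunit : ∀ s : S, IsUnit (i s) := fun s => OreLocalization.numerator_isUnit s
  refine ⟨OreLocalization S R, inferInstance, i, ?_, ?_, ?_⟩
  · intro z hz
    rw [Subring.mem_center_iff] at hz ⊢
    intro x
    induction x using OreLocalization.ind with
    | _ r s =>
      have hs : ∀ x, i s * x = x * i s := by
        obtain ⟨_, ⟨m, rfl⟩, hm⟩ := s
        intro x
        simp only [map_natCast]
        exact Nat.cast_comm m x
      have hr : i s * OreLocalization.oreDiv r s = i r := OreLocalization.mul_cancel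
      -- Clearing the denominator reduces the claim to commutation of `z` with the numerator `r`.
      apply (hunit s).mul_left_cancel
      rw [← mul_assoc, hr, ← mul_assoc, hs, mul_assoc, hr, ← map_mul, ← map_mul, hz]
  · exact OreLocalization.numeratorHom_inj fun s hs r hr => hs.2 r hr
  · intro m hm
    simpa using hunit ⟨(m : R), ⟨m, rfl⟩, hm⟩

/-- Averaging a twisted cocycle over a subgroup of finite index on which it vanishes shows that its
multiple by the index is a coboundary. -/
theorem exists_index_nsmul_eq_coboundary {G : Type v} [Group G] {A : Type*} [Ring A]
    (H : Subgroup G) [H.FiniteIndex] (s t : G →* A) (d : G → A)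
    (hd : ∀ g h, d (g * h) = d g * t h + s g * d h) (hH : ∀ h ∈ H, d h = 0) :
    ∃ β ∈ Subring.closure (Set.range d ∪ Set.range t),
      ∀ h, H.index • d h = β * t h - s h * β := by
  classical
  let _ := H.fintypeQuotientOfFiniteIndex
  have hinv : ∀ g h : G, t (g * h)⁻¹ * t g = t h⁻¹ := by
    intro g h
    rw [← map_mul]
    congr 1
    group
  have hwd : ∀ g h : G, h ∈ H → d (g * h) * t (g * h)⁻¹ = d g * t g⁻¹ := by
    intro g h hh
    rw [hd, hH h hh, mul_zero, add_zero, mul_assoc, ← map_mul]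
    congr 2
    group
  let F : G ⧸ H → A := fun q => d q.out * t q.out⁻¹
  have hF : ∀ g : G, F (g : G ⧸ H) = d g * t g⁻¹ := by
    intro g
    obtain ⟨h, hh⟩ := QuotientGroup.mk_out_eq_mul H g
    simp only [F, hh]
    exact hwd g h h.2
  -- Membership in the closure is what later makes the sum commute with scalars.
  refine ⟨∑ q, F q, sum_mem fun q _ => mul_mem (Subring.subset_closure (Or.inl ⟨_, rfl⟩))
    (Subring.subset_closure (Or.inr ⟨_, rfl⟩)), fun h => ?_⟩
  -- This is the cocycle identity for `h * g`, multiplied on the right by `t g⁻¹`; summing over `q`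
  -- only permutes the cosets.
  have hstep : ∀ q : G ⧸ H, s h * F q = F (h • q) * t h - d h := by
    intro q
    induction q using QuotientGroup.induction_on with
    | _ g =>
      have e : t (h * g)⁻¹ * t h = t g⁻¹ := hinv h g
      have e' : t g * t g⁻¹ = 1 := by rw [← map_mul, mul_inv_cancel, map_one]
      rw [MulAction.Quotient.smul_coe, smul_eq_mul, hF, hF, mul_assoc, e, hd, add_mul, mul_assoc,
        e', mul_one, mul_assoc, add_sub_cancel_left]
  have hsum : ∑ q : G ⧸ H, F (h • q) = ∑ q, F q :=
    Equiv.sum_comp (MulAction.toPerm h) F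
  rw [Finset.mul_sum, Finset.sum_congr rfl fun q _ => hstep q, Finset.sum_sub_distrib,
    ← Finset.sum_mul, hsum, sub_sub_cancel, Finset.sum_const, Finset.card_univ,
    Subgroup.index_eq_card, Nat.card_eq_fintype_card]

namespace TwistedDer

open MonoidAlgebra

variable {S : Type u} [Ring S] {G : Type v} [Group G]

/-- A group ring has no torsion at `n` if its coefficient ring has none. -/
theorem nsmul_eq_zero_imp {n : ℕ} (htors : ∀ s : S, n • s = 0 → s = 0) {y : MonoidAlgebra S G}
    (hy : n • y = 0) : y = 0 := by
  ext g
  exact htors _ (congrArg (fun w : MonoidAlgebra S G => w.coeff g) hy)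

theorem smul_eq_single_one_mul (s : S) (y : MonoidAlgebra S G) : s • y = single 1 s * y := by
  ext h
  simp

theorem mul_single_eq_of_mem_center {z : G} (hz : z ∈ Subgroup.center G)
    (y : MonoidAlgebra S G) : y * single z 1 = single z 1 * y :=
  ((single_commute (fun g => (Subgroup.mem_center_iff.1 hz g).symm)
    fun _ => Commute.one_left _) y).symm

theorem derivation_apply_one {A : Type v} [Ring A] [Module S A] {σ τ : A →+* A}
    {δ : A →ₗ[S] A} (hδ : δ ∈ derivations S σ τ) : δ 1 = 0 := by
  have h := hδ 1 1
  simp only [mul_one, map_one, one_mul] at h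
  simpa using h

/-- A twisted derivation of a group ring kills the central group elements of finite order that both
endomorphisms fix, when the coefficient ring has no torsion at their order. -/
theorem derivation_apply_central_eq_zero {σ τ : MonoidAlgebra S G →+* MonoidAlgebra S G}
    {δ : MonoidAlgebra S G →ₗ[S] MonoidAlgebra S G} (hδ : δ ∈ derivations S σ τ) {z : G}
    (hz : z ∈ Subgroup.center G)
    (hfin : IsOfFinOrder z) (hσ : σ (single z 1) = single z 1)
    (hτ : τ (single z 1) = single z 1)
    (htors : ∀ s : S, orderOf z • s = 0 → s = 0) : δ (single z 1) = 0 := by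
  have hpow : ∀ n : ℕ, δ (single z 1 ^ (n + 1)) = (n + 1) • (single z 1 ^ n * δ (single z 1)) := by
    intro n
    induction n with
    | zero => simp
    | succ n ih =>
      rw [pow_succ, hδ, ih, hτ, map_pow, hσ,
        mul_single_eq_of_mem_center hz, mul_smul_comm, ← mul_assoc, ← pow_succ',
        ← succ_nsmul]
  obtain ⟨n, hn⟩ := Nat.exists_eq_succ_of_ne_zero hfin.orderOf_pos.ne'
  have hone : (single z 1 : MonoidAlgebra S G) ^ (n + 1) = 1 := by
    rw [single_pow, ← Nat.succ_eq_add_one, ← hn, pow_orderOf_eq_one, one_pow, one_def]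
  have h0 : single z 1 ^ n * δ (single z 1) = 0 := by
    refine nsmul_eq_zero_imp htors ?_
    rw [hn, Nat.succ_eq_add_one, ← hpow, hone, derivation_apply_one hδ]
  -- One more factor `z` completes `zⁿ` to `1`.
  rw [← one_mul (δ (single z 1)), ← hone, pow_succ', mul_assoc, h0, mul_zero]

theorem exists_nsmul_eq_of_isUnit {X : Type*} {n : ℕ} (hn : IsUnit (n : S)) (y : MonoidAlgebra S X) :
    ∃ x : MonoidAlgebra S X, n • x = y := by
  obtain ⟨u, hu⟩ := hn
  refine ⟨(↑u⁻¹ : S) • y, ?_⟩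
  rw [← Nat.cast_smul_eq_nsmul S, smul_smul, ← hu, Units.mul_inv, one_smul]

theorem nsmul_injective_of_isUnit {n : ℕ} (hn : IsUnit (n : S)) :
    Function.Injective fun y : MonoidAlgebra S G => n • y := by
  intro x y hxy
  rw [← sub_eq_zero]
  refine nsmul_eq_zero_imp (n := n) (fun s hs => ?_) (by rw [nsmul_sub]; exact sub_eq_zero.2 hxy)
  rw [nsmul_eq_mul] at hs
  exact hn.mul_right_eq_zero.1 hs

/-- Over a group with center of finite index, the multiple of a twisted derivation by that index is
inner, provided that the derivation kills the center of the group. -/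
theorem exists_index_nsmul_eq_inner [(Subgroup.center G).FiniteIndex]
    {σ τ : MonoidAlgebra S G →+* MonoidAlgebra S G}
    (hσ : ∀ (s : S) x, σ (s • x) = s • σ x) (hτ : ∀ (s : S) x, τ (s • x) = s • τ x)
    {δ : MonoidAlgebra S G →ₗ[S] MonoidAlgebra S G} (hδ : δ ∈ derivations S σ τ)
    (hz : ∀ z ∈ Subgroup.center G, δ (single z 1) = 0) :
    ∃ β, ∀ x, (Subgroup.center G).index • δ x = β * τ x - σ x * β := by
  obtain ⟨β, hβ, h⟩ := exists_index_nsmul_eq_coboundary (Subgroup.center G)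
    ((σ : MonoidAlgebra S G →* MonoidAlgebra S G).comp (of S G))
    ((τ : MonoidAlgebra S G →* MonoidAlgebra S G).comp (of S G)) (fun g => δ (single g 1))
    (fun g k => by
      have := hδ (single g 1) (single k 1)
      simpa [single_mul_single] using this)
    hz
  have hscalar : ∀ {ρ : MonoidAlgebra S G →+* MonoidAlgebra S G},
      (∀ (s : S) x, ρ (s • x) = s • ρ x) → ∀ s : S, ρ (single 1 s) = single 1 s := by
    intro ρ hρ s
    have := hρ s 1
    rwa [map_one, smul_eq_single_one_mul, mul_one] at this
  have hcomm : ∀ (s : S) (g : G), (single g 1 : MonoidAlgebra S G) * single 1 s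
      = single 1 s * single g 1 := fun s g => by simp [single_mul_single]
  have hβs : ∀ s : S, β * single 1 s = single 1 s * β := by
    intro s
    -- `S` need not be commutative and `δ` is only left linear, so `β` must be shown to commute with
    -- scalars. For `δ g`, expand `δ` on both sides of `g s = s g`, using `δ s = 0`.
    have hle : Subring.closure (Set.range (fun g : G => δ (single g 1)) ∪ Set.range
        ((τ : MonoidAlgebra S G →* MonoidAlgebra S G).comp (of S G))) ≤
        Subring.centralizer {(single 1 s : MonoidAlgebra S G)} := by
      rw [Subring.closure_le]
      rintro _ (⟨g, rfl⟩ | ⟨g, rfl⟩) <;> rw [SetLike.mem_coe, Subring.mem_centralizer_iff] <;>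
        rintro _ rfl
      · have h1 : δ (single 1 s) = 0 := by
          rw [← mul_one (single 1 s), ← smul_eq_single_one_mul, map_smul,
            derivation_apply_one hδ, smul_zero]
        have h2 := hδ (single g 1) (single 1 s)
        rw [h1, mul_zero, add_zero, hscalar hτ, hcomm, ← smul_eq_single_one_mul, map_smul,
          smul_eq_single_one_mul] at h2
        exact h2
      · have h2 := congrArg τ (hcomm s g)
        rw [map_mul, map_mul, hscalar hτ] at h2
        exact h2.symm
    exact (Subring.mem_centralizer_iff.1 (hle hβ) _ rfl).symm
  refine ⟨β, fun x => ?_⟩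
  induction x using MonoidAlgebra.induction_on with
  | of g => exact h g
  | add x y hx hy => rw [map_add, map_add, map_add, smul_add, hx, hy, mul_add, add_mul]; abel
  | smul s x hx =>
    rw [map_smul, hσ, hτ, smul_comm, hx, smul_eq_single_one_mul, smul_eq_single_one_mul s (τ x),
      smul_eq_single_one_mul s (σ x), mul_sub, ← mul_assoc, ← mul_assoc, ← hβs, mul_assoc,
      mul_assoc]

/-- A twisted derivation is inner if the index of the center of the group is a unit. -/
theorem subsingleton_H1_of_isUnit_index [(Subgroup.center G).FiniteIndex]
    {σ τ : MonoidAlgebra S G →+* MonoidAlgebra S G}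
    (hσ : ∀ (s : S) x, σ (s • x) = s • σ x) (hτ : ∀ (s : S) x, τ (s • x) = s • τ x)
    (hz : ∀ δ ∈ derivations S σ τ, ∀ z ∈ Subgroup.center G, δ (single z 1) = 0)
    (hu : IsUnit ((Subgroup.center G).index : S)) : Subsingleton (H1 S σ τ) := by
  rw [H1, QuotientAddGroup.subsingleton_iff, AddSubgroup.addSubgroupOf_eq_top]
  intro δ hδ
  obtain ⟨β, hβ⟩ := exists_index_nsmul_eq_inner hσ hτ hδ (hz δ hδ)
  obtain ⟨α, hα⟩ := exists_nsmul_eq_of_isUnit hu β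
  refine ⟨α, fun x => nsmul_injective_of_isUnit hu ?_⟩
  simp only [hβ, nsmul_sub, ← hα, smul_mul_assoc, mul_smul_comm]

theorem IsCentralEndo.map_single {σ : MonoidAlgebra S G →+* MonoidAlgebra S G}
    (hσ : IsCentralEndo σ) {z : G} (hz : z ∈ Subgroup.center G) :
    σ (single z 1) = single z 1 :=
  hσ.fix_center _ (Subring.mem_center_iff.2 (mul_single_eq_of_mem_center hz))

theorem natExt_single {T : Type u} [Ring T] (i : S →+* T)
    (hi : ∀ z ∈ Subring.center S, i z ∈ Subring.center T)
    {σ : MonoidAlgebra S G →+* MonoidAlgebra S G}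
    (hσ : IsCentralEndo σ) {z : G} (hz : z ∈ Subgroup.center G) :
    natExt i hi σ hσ (single z 1) = single z 1 := by
  have := natExt_mapRingHom i hi σ hσ (single z 1)
  simpa [hσ.map_single hz] using this

end TwistedDer

/-- A positive integer is regular on a ring without torsion at its prime divisors. -/
theorem natCast_mul_eq_zero_imp {R : Type u} [Ring R] {n : ℕ} (hn : n ≠ 0)
    (h : ∀ p : ℕ, p.Prime → p ∣ n → ¬ HasTorsionAt R p) (r : R) (hr : (n : R) * r = 0) : r = 0 := by
  induction n using Nat.recOnMul generalizing r with
  | zero => exact absurd rfl hn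
  | one => simpa using hr
  | prime p hp =>
    by_contra h0
    exact h p hp dvd_rfl ⟨r, h0, by rwa [nsmul_eq_mul]⟩
  | mul a b iha ihb =>
    rw [Nat.cast_mul, mul_assoc] at hr
    exact ihb (right_ne_zero_of_mul hn) (fun p hp hd => h p hp (hd.mul_left a)) _
      (iha (left_ne_zero_of_mul hn) (fun p hp hd => h p hp (hd.mul_right b)) _ hr)

/-- Every prime divisor of the index of a normal subgroup of finite index divides the order of some
element of the group. -/
theorem exists_dvd_orderOf_of_dvd_index {G : Type v} [Group G] (H : Subgroup G) [H.Normal]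
    [H.FiniteIndex] {p : ℕ} (hp : p.Prime) (hd : p ∣ H.index) : ∃ g : G, p ∣ orderOf g := by
  have : Fact p.Prime := ⟨hp⟩
  obtain ⟨q, hq⟩ := exists_prime_orderOf_dvd_card' (G := G ⧸ H) p
    (by rwa [← Subgroup.index_eq_card])
  obtain ⟨g, rfl⟩ := QuotientGroup.mk'_surjective H q
  exact ⟨g, hq ▸ orderOf_map_dvd _ g⟩

open TwistedDer in
theorem theorem1p1 {R : Type u} [Ring R] {G : Type v} [Group G]
    (hG : IsMulTorsion G) (hGZ : (Subgroup.center G).FiniteIndex)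
    (hR : IsSemiprimeRing R)
    (hRG : ∀ p : ℕ, p.Prime → HasTorsionAt R p → ∀ g : G, ¬ p ∣ orderOf g)
    (σ τ : MonoidAlgebra R G →+* MonoidAlgebra R G)
    (hσ : IsCentralEndo σ) (hτ : IsCentralEndo τ) :
    ∃ (T : Type u) (_ : Ring T) (i : R →+* T)
      (hi : ∀ z ∈ Subring.center R, i z ∈ Subring.center T),
      Function.Injective i ∧
      Subsingleton (H1 T (natExt i hi σ hσ) (natExt i hi τ hτ)) ∧
      ∀ δ ∈ derivations R σ τ, ∃ α : MonoidAlgebra T G, ∀ x : MonoidAlgebra R G,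
        MonoidAlgebra.mapRingHom G i (δ x) =
          α * MonoidAlgebra.mapRingHom G i (τ x) - MonoidAlgebra.mapRingHom G i (σ x) * α := by
  have hreg_order : ∀ g : G, ∀ r : R, (orderOf g : R) * r = 0 → r = 0 := fun g =>
    natCast_mul_eq_zero_imp (hG g).orderOf_pos.ne' fun p hp hd ht => hRG p hp ht g hd
  have hreg_index : ∀ r : R, ((Subgroup.center G).index : R) * r = 0 → r = 0 :=
    natCast_mul_eq_zero_imp hGZ.index_ne_zero fun p hp hd ht => by
      obtain ⟨g, hg⟩ := exists_dvd_orderOf_of_dvd_index _ hp hd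
      exact hRG p hp ht g hg
  obtain ⟨T, _, i, hi, hinj, hunit⟩ := exists_natCast_localization R
  have hu := hunit _ hreg_index
  refine ⟨T, inferInstance, i, hi, hinj, ?_, fun δ hδ => ?_⟩
  · refine subsingleton_H1_of_isUnit_index (natExt_smul i hi σ hσ) (natExt_smul i hi τ hτ)
      (fun δ hδ z hz => derivation_apply_central_eq_zero hδ hz (hG z) (natExt_single i hi hσ hz)
        (natExt_single i hi hτ hz) fun t ht => ?_) hu
    rw [nsmul_eq_mul] at ht
    exact (hunit _ (hreg_order z)).mul_right_eq_zero.1 ht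
  -- Averaging already works over `R`; only the division by the index takes place in `T`, so `δ`
  -- need not be extended to `TG`.
  · obtain ⟨β, hβ⟩ := exists_index_nsmul_eq_inner hσ.map_smul hτ.map_smul hδ fun z hz =>
      derivation_apply_central_eq_zero hδ hz (hG z) (hσ.map_single hz) (hτ.map_single hz)
        fun r hr => hreg_order z r (by rwa [← nsmul_eq_mul])
    obtain ⟨α, hα⟩ := exists_nsmul_eq_of_isUnit hu (MonoidAlgebra.mapRingHom G i β)
    refine ⟨α, fun x => nsmul_injective_of_isUnit hu ?_⟩
    have := congrArg (MonoidAlgebra.mapRingHom G i) (hβ x)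
    simpa only [map_nsmul, map_sub, map_mul, ← hα, smul_mul_assoc, mul_smul_comm, ← nsmul_sub]
      using this
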